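/- Let $\mathbf{Met}$ be the symmetric monoidal closed category of extended metric spaces (distance $\infty$ allowed) and nonexpanding maps, with the addition metric on tensor products. A metric-enriched category $\mathcal K$ is a category whose hom-sets carry extended metrics such that composition is nonexpanding for the addition metric; weighted (and in particular conical) colimits are understood in the enriched sense. A morphism $m\colon P\to X$ is an *isometric embedding* if $d(u_1,u_2)=d(m u_1,m u_2)$ for all parallel pairs $u_1,u_2\colon U\to P$. Let $\mathcal B$ be the category obtained from the chain of all real numbers $\varepsilon\ge 0$ by adding an object $a$ and two cocones $l_\varepsilon,r_\varepsilon\colon\varepsilon\to a$, discretely enriched. The basic weight $B\colon\mathcal B^{\mathrm{op}}\to\mathbf{Met}$ has $Ba=\{*\}$, $B\varepsilon=\{0,1\}$ with $d(0,1)=\varepsilon$ (a single point for $\varepsilon=0$), $Bl_\varepsilon(*)=0$, $Br_\varepsilon(*)=1$, and identity-carried maps $B(\varepsilon\to\varepsilon')$. The *colimit map* of a diagram $D\colon\mathcal B\to\mathcal K$ is the morphism $f=u_a(*)\colon Da\to C$, where $u$ is the unit of the weighted colimit $C=\operatorname{colim}_B D$. A *subregular epimorphism* is a morphism that is the colimit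 map of some $D\colon\mathcal B\to\mathcal K$. The *$\varepsilon$-kernel pair* of $f\colon X\to Y$ is a pair $p,p'\colon P\to X$ with $d(fp,fp')\le\varepsilon$, isometric in the sense that $d(u_1,u_2)=\max\{d(pu_1,pu_2),d(p'u_1,p'u_2)\}$ for all parallel pairs $u_1,u_2\colon U\to P$, and such that every pair $q,q'\colon Q\to X$ with $d(fq,fq')\le\varepsilon$ factorizes through $(p,p')$. The *kernel diagram* of $f$ is the diagram $D\colon\mathcal B\to\mathcal K$ with $Da=X$ for which $(Dl_\varepsilon,Dr_\varepsilon)$ is the $\varepsilon$-kernel pair of $f$ for every $\varepsilon\ge0$. An object $G$ of $\mathcal K$ is a *subvarietal generator* if (i) $G$ has tensors: $M\otimes G$ exists for every $M\in\mathbf{Met}$, with isomorphisms $\mathcal K(M\otimes G,X)\cong\mathbf{Met}(M,\mathcal K(G,X))$ in $\mathbf{Met}$, natural in $X$; (ii) for every object $K$ the evaluation morphism $\mathcal K(G,K)\otimes G\to K$ is a subregular epimorphism; (iii) $G$ is abstractly finite: every morphism from $G$ to a copower $\coprod_M G$ factorizes through $\coprod_{M'}G$ for some finite $M'\subseteq M$;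 and (iv) $G$ is a subregular projective: every morphism from $G$ to $Y$ factorizes through each subregular epimorphism $X\to Y$. **Proposition.** Let $\mathcal K$ be a metric-enriched category with (conical) coequalizers of reflexive pairs and a subvarietal generator. Then $\mathcal K$ has the factorization system $(\mathcal E,\mathcal M)$ with $\mathcal E$ the subregular epimorphisms and $\mathcal M$ the isometric embeddings: both classes contain all isomorphisms and are closed under composition; every morphism $f$ has a factorization $f=m\cdot e$ with $e\in\mathcal E$ and $m\in\mathcal M$; and for every commutative square $m\cdot p=q\cdot e$ with $e\in\mathcal E$ and $m\in\mathcal M$ there is a unique $d$ with $d\cdot e=p$ and $m\cdot d=q$. Moreover, every morphism $f\colon X\to Y$ has a kernel diagram $D$, the colimit of $D$ weighted by $B$ exists, and, for every such colimit with colimit map $e\colon X\to Z$, the morphism $e$ is a subregular epimorphism, there is a unique $m\colon Z\to Y$ with $f=m\cdot e$, and this $m$ is an isometric embedding. -/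

import Mathlib

open CategoryTheory Opposite
open scoped NNReal ENNReal

universe w w' v u

namespace MetEnr

/-! ### The category of extended metric spaces and nonexpanding maps -/

/-- An extended metric space: distances are in `[0, ∞]`, and `d(x, y) = 0` only for `x = y`. -/
structure Met : Type (v + 1) where
  carrier : Type v
  [str : EMetricSpace carrier]

instance : CoeSort Met.{v} (Type v) := ⟨Met.carrier⟩

instance (M : Met.{v}) : EMetricSpace M := M.str

/-- Morphisms of `Met`: nonexpanding maps. -/
@[ext]
structure Met.Hom (M N : Met.{v}) : Type v where
  toFun : M → N
  nonexpanding : ∀ x y : M, edist (toFun x) (toFun y) ≤ edist x y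

instance : Category.{v} Met.{v} where
  Hom M N := Met.Hom M N
  id _ := ⟨fun x => x, fun _ _ => le_rfl⟩
  comp f g := ⟨fun x => g.toFun (f.toFun x), fun x y =>
    (g.nonexpanding _ _).trans (f.nonexpanding x y)⟩

/-- The function underlying a morphism of `Met`. -/
def Met.fn {M N : Met.{v}} (f : M ⟶ N) : M → N := Met.Hom.toFun f

/-! ### Categories enriched over `Met` -/

/-- A metric-enriched category: every hom-set carries an extended metric, and composition is
nonexpanding with respect to the addition metric. -/
class MetEnriched (C : Type u) [Category.{v} C] where
  [emetric : ∀ X Y : C, EMetricSpace (X ⟶ Y)]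
  edist_comp_le : ∀ {X Y Z : C} (f f' : X ⟶ Y) (g g' : Y ⟶ Z),
    edist (f ≫ g) (f' ≫ g') ≤ edist f f' + edist g g'

attribute [reducible, instance] MetEnriched.emetric

/-- The supremum metric on the hom-sets of `Met`. -/
noncomputable instance Met.homEMetric (M N : Met.{v}) : EMetricSpace (M ⟶ N) where
  edist f g := ⨆ x : M, edist (Met.fn f x) (Met.fn g x)
  edist_self f := by simp
  edist_comm f g := by simp only [edist_comm]
  edist_triangle f g h := iSup_le fun x =>
    (edist_triangle _ (Met.fn g x) _).trans
      (add_le_add (le_iSup (fun x : M => edist (Met.fn f x) (Met.fn g x)) x)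
        (le_iSup (fun x : M => edist (Met.fn g x) (Met.fn h x)) x))
  eq_of_edist_eq_zero {f g} h := Met.Hom.ext <| funext fun x =>
    eq_of_edist_eq_zero (le_antisymm
      ((le_iSup (fun x : M => edist (Met.fn f x) (Met.fn g x)) x).trans h.le) zero_le)

/-- `Met` is enriched over itself. -/
noncomputable instance : MetEnriched Met.{v} where
  edist_comp_le f f' g g' := iSup_le fun x =>
    (edist_triangle _ (Met.fn g (Met.fn f' x)) _).trans
      (add_le_add
        ((Met.Hom.nonexpanding g _ _).trans
          (le_iSup (fun x => edist (Met.fn f x) (Met.fn f' x)) x))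
        (le_iSup (fun y => edist (Met.fn g y) (Met.fn g' y)) (Met.fn f' x)))

section

variable {C : Type u} [Category.{v} C] [MetEnriched C]

/-- The hom-space `C(X, Y)`, an object of `Met`. -/
def homSpace (X Y : C) : Met.{v} := ⟨X ⟶ Y⟩

/-- Precomposition with `f`, as a nonexpanding map of hom-spaces. -/
def precompHom {X X' : C} (f : X' ⟶ X) (Y : C) : homSpace X Y ⟶ homSpace X' Y :=
  Met.Hom.mk (M := homSpace X Y) (N := homSpace X' Y) (fun (g : X ⟶ Y) => f ≫ g)
    (fun (g g' : X ⟶ Y) => 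
      (MetEnriched.edist_comp_le f f g g').trans_eq (by rw [edist_self, zero_add]; rfl))

/-- Postcomposition with `h`, as a nonexpanding map of hom-spaces. -/
def postcompHom (X : C) {Y Y' : C} (h : Y ⟶ Y') : homSpace X Y ⟶ homSpace X Y' :=
  Met.Hom.mk (M := homSpace X Y) (N := homSpace X Y') (fun (g : X ⟶ Y) => g ≫ h)
    (fun (g g' : X ⟶ Y) => 
      (MetEnriched.edist_comp_le g g' h h).trans_eq (by rw [edist_self, add_zero]; rfl))

/-! ### Isometric embeddings, quotients, relations -/

/-- `p` is an isometric embedding: `d(u₁, u₂) = d(p · u₁, p · u₂)` for all parallel `u₁, u₂`. -/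
def IsIsometricEmbedding {P X : C} (p : P ⟶ X) : Prop :=
  ∀ ⦃U : C⦄ (u₁ u₂ : U ⟶ P), edist u₁ u₂ = edist (u₁ ≫ p) (u₂ ≫ p)

/-- `p` is a quotient: `d(u₁, u₂) = d(u₁ · p, u₂ · p)` for all parallel `u₁, u₂`. -/
def IsQuotient {P X : C} (p : P ⟶ X) : Prop :=
  ∀ ⦃U : C⦄ (u₁ u₂ : X ⟶ U), edist u₁ u₂ = edist (p ≫ u₁) (p ≫ u₂)

/-- An isometric parallel pair (a relation on `X`). -/
def IsIsometricPair {P X : C} (p p' : P ⟶ X) : Prop :=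
  ∀ ⦃U : C⦄ (u₁ u₂ : U ⟶ P),
    edist u₁ u₂ = max (edist (u₁ ≫ p) (u₂ ≫ p)) (edist (u₁ ≫ p') (u₂ ≫ p'))

/-- `(p, p')` is the `ε`-kernel pair of `f`: the universal pair with `d(f · p, f · p') ≤ ε`. -/
structure IsEpsKernelPair (ε : ℝ≥0) {P X Y : C} (f : X ⟶ Y) (p p' : P ⟶ X) : Prop where
  isometric : IsIsometricPair p p'
  edist_le : edist (p ≫ f) (p' ≫ f) ≤ (ε : ℝ≥0∞)
  factors : ∀ ⦃Q : C⦄ (q q' : Q ⟶ X), edist (q ≫ f) (q' ≫ f) ≤ (ε : ℝ≥0∞) →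
    ∃ t : Q ⟶ P, t ≫ p = q ∧ t ≫ p' = q'

/-! ### Weighted colimits -/

variable {J : Type w} [Category.{w'} J]

/-- The functor `C(D -, X) : Jᵒᵖ ⥤ Met`. -/
def homFunctor (D : J ⥤ C) (X : C) : Jᵒᵖ ⥤ Met.{v} where
  obj j := homSpace (D.obj j.unop) X
  map f := precompHom (D.map f.unop) X
  map_id j := by
    apply Met.Hom.ext; funext (g : D.obj j.unop ⟶ X)
    change D.map (𝟙 j.unop) ≫ g = g
    simp
  map_comp {i j k} f f' := by
    apply Met.Hom.ext; funext (g : D.obj i.unop ⟶ X)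
    change D.map (f'.unop ≫ f.unop) ≫ g = D.map f'.unop ≫ D.map f.unop ≫ g
    simp

/-- The natural transformation `C(D -, h) : C(D -, X) ⟶ C(D -, Y)`. -/
def homFunctorMap (D : J ⥤ C) {X Y : C} (h : X ⟶ Y) : homFunctor D X ⟶ homFunctor D Y where
  app j := postcompHom (D.obj j.unop) h
  naturality i j f := by
    apply Met.Hom.ext; funext (g : D.obj i.unop ⟶ X)
    change (D.map f.unop ≫ g) ≫ h = D.map f.unop ≫ g ≫ h
    simp

/-- `Z` is the colimit of `D` weighted by `W`, with unit `u : W ⟶ C(D -, Z)`. That is, the maps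
`C(Z, X) → [Jᵒᵖ, Met](W, C(D -, X))`, `h ↦ C(D -, h) · u`, are isomorphisms in `Met` (bijective
isometries), where the distance of natural transformations is the supremum of the distances of
their components. The shape `J` is understood to be discretely enriched (distinct morphisms have
distance `∞`), so that every functor on it is an enriched functor. -/
structure IsWeightedColimit (W : Jᵒᵖ ⥤ Met.{v}) (D : J ⥤ C) (Z : C)
    (u : W ⟶ homFunctor D Z) : Prop where
  bijective : ∀ X : C, Function.Bijective (fun h : Z ⟶ X => u ≫ homFunctorMap D h)
  isometry : ∀ (X : C) (h h' : Z ⟶ X),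
    edist h h' = ⨆ j : Jᵒᵖ, edist ((u ≫ homFunctorMap D h).app j) ((u ≫ homFunctorMap D h').app j)

end

/-! ### The basic shape and the basic weight -/

/-- Objects of the basic shape: the real numbers `ε ≥ 0` and one further object `a`. -/
inductive BasicShape : Type
  | num (ε : ℝ≥0) : BasicShape
  | a : BasicShape

/-- The two cocones `l`, `r`. -/
inductive Side : Type
  | l : Side
  | r : Side

/-- Morphisms of the basic shape: one `ε ⟶ ε'` for `ε ≤ ε'`, two morphisms `l_ε, r_ε : ε ⟶ a`,
and the identity of `a`. -/
def BasicShape.Hom : BasicShape → BasicShape → Type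
  | .num ε, .num ε' => PLift (ε ≤ ε')
  | .num _, .a => Side
  | .a, .a => PUnit
  | .a, .num _ => PEmpty

/-- Identities of the basic shape. -/
def BasicShape.id : ∀ i : BasicShape, BasicShape.Hom i i
  | .num _ => PLift.up le_rfl
  | .a => PUnit.unit

/-- Composition in the basic shape: both cocones are compatible with the chain. -/
def BasicShape.comp : ∀ {i j k : BasicShape},
    BasicShape.Hom i j → BasicShape.Hom j k → BasicShape.Hom i k
  | .num _, .num _, .num _, f, g => PLift.up (f.down.trans g.down)
  | .num _, .num _, .a, _, s => s
  | .num _, .a, .a, s, _ => s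
  | .a, .a, .a, _, _ => PUnit.unit
  | .a, .num _, _, f, _ => f.elim
  | .num _, .a, .num _, _, g => g.elim
  | .a, .a, .num _, _, g => g.elim

instance : Category.{0} BasicShape where
  Hom := BasicShape.Hom
  id := BasicShape.id
  comp := BasicShape.comp
  id_comp {i j} f := by cases i <;> cases j <;> first | rfl | exact f.elim
  comp_id {i j} f := by cases i <;> cases j <;> first | rfl | exact f.elim
  assoc {i j k l} f g h := by
    cases i <;> cases j <;> cases k <;> cases l <;>
      first | rfl | exact PEmpty.elim f | exact PEmpty.elim g | exact PEmpty.elim h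

/-- The morphism `ε ⟶ ε'` of the chain. -/
def BasicShape.step {ε ε' : ℝ≥0} (h : ε ≤ ε') : BasicShape.num ε ⟶ BasicShape.num ε' :=
  (PLift.up h : PLift (ε ≤ ε'))

/-- `l_ε : ε ⟶ a`. -/
def BasicShape.left (ε : ℝ≥0) : BasicShape.num ε ⟶ BasicShape.a := (Side.l : Side)

/-- `r_ε : ε ⟶ a`. -/
def BasicShape.right (ε : ℝ≥0) : BasicShape.num ε ⟶ BasicShape.a := (Side.r : Side)

/-- The space `{0, ε}` with `d(0, ε) = ε`, that is, the two-point space with distance `ε` (for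
`ε = 0` the two points coincide). -/
noncomputable def twoPoint (ε : ℝ≥0) : Met.{v} :=
  ⟨ULift.{v} {x : ℝ≥0 // x = 0 ∨ x = ε}⟩

/-- The one-point space. -/
noncomputable def onePoint : Met.{v} := ⟨PUnit.{v + 1}⟩

/-- The point of `twoPoint ε` on the given side: `0` on the left, `ε` on the right. -/
def twoPoint.pt (ε : ℝ≥0) : Side → twoPoint.{v} ε
  | .l => ULift.up ⟨0, Or.inl rfl⟩
  | .r => ULift.up ⟨ε, Or.inr rfl⟩

/-- The identity-like map `twoPoint ε' ⟶ twoPoint ε` for `ε ≤ ε'`: `0 ↦ 0` and `ε' ↦ ε`. -/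
noncomputable def twoPoint.shrink {ε ε' : ℝ≥0} (h : ε ≤ ε') : twoPoint.{v} ε' ⟶ twoPoint.{v} ε :=
  Met.Hom.mk (M := twoPoint.{v} ε') (N := twoPoint.{v} ε)
    (fun (x : ULift.{v} {x : ℝ≥0 // x = 0 ∨ x = ε'}) => ULift.up ⟨min x.down.1 ε, by
      rcases x.down.2 with hx | hx
      · left; rw [hx]; exact min_eq_left zero_le
      · right; rw [hx]; exact min_eq_right h⟩)
    (fun (x y : ULift.{v} {x : ℝ≥0 // x = 0 ∨ x = ε'}) => by
      change edist (min x.down.1 ε) (min y.down.1 ε) ≤ edist x.down.1 y.down.1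
      rw [edist_nndist, edist_nndist, ENNReal.coe_le_coe, ← NNReal.coe_le_coe, coe_nndist,
        coe_nndist, NNReal.dist_eq, NNReal.dist_eq, NNReal.coe_min, NNReal.coe_min]
      simpa using abs_min_sub_min_le_max (x.down.1 : ℝ) ε y.down.1 ε)

/-- The map `onePoint ⟶ M` with the given value. -/
def Met.point {M : Met.{v}} (x : M) : onePoint.{v} ⟶ M :=
  Met.Hom.mk (M := onePoint.{v}) (N := M) (fun _ => x) (fun _ _ => by simp)

/-- The basic weight on objects: `B ε = {0, ε}` and `B a` is a point. -/
noncomputable def basicWeightObj : BasicShape → Met.{v}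
  | .num ε => twoPoint ε
  | .a => onePoint

/-- The basic weight on morphisms: `B l_ε` and `B r_ε` are the two points of `B ε`. -/
noncomputable def basicWeightMap : ∀ {i j : BasicShape}, BasicShape.Hom i j →
    (basicWeightObj.{v} j ⟶ basicWeightObj.{v} i)
  | .num _, .num _, f => twoPoint.shrink f.down
  | .num ε, .a, s => Met.point (M := twoPoint.{v} ε) (twoPoint.pt ε s)
  | .a, .a, _ => 𝟙 _
  | .a, .num _, f => f.elim

/-- The basic weight `B : BasicShapeᵒᵖ ⥤ Met`. -/
noncomputable def basicWeight : BasicShapeᵒᵖ ⥤ Met.{v} where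
  obj i := basicWeightObj i.unop
  map f := basicWeightMap f.unop
  map_id i := by
    obtain ⟨i⟩ := i
    cases i with
    | num ε =>
      apply Met.Hom.ext; funext (x : ULift.{v} {x : ℝ≥0 // x = 0 ∨ x = ε})
      apply ULift.ext; apply Subtype.ext
      change min x.down.1 ε = x.down.1
      rcases x.down.2 with hx | hx <;> simp [hx]
    | a => rfl
  map_comp {i j k} f g := by
    obtain ⟨i⟩ := i; obtain ⟨j⟩ := j; obtain ⟨k⟩ := k
    obtain ⟨f⟩ := f; obtain ⟨g⟩ := g
    cases k with
    | a =>
      cases j with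
      | num _ => exact PEmpty.elim g
      | a =>
        cases i with
        | num _ => exact PEmpty.elim f
        | a => rfl
    | num ε₃ =>
      cases j with
      | num ε₂ =>
        cases i with
        | num ε₁ =>
          apply Met.Hom.ext; funext (x : ULift.{v} {x : ℝ≥0 // x = 0 ∨ x = ε₁})
          apply ULift.ext; apply Subtype.ext
          change min x.down.1 ε₃ = min (min x.down.1 ε₂) ε₃
          have h : ε₃ ≤ ε₂ := PLift.down g
          rw [min_assoc, min_eq_right h]
        | a =>
          have h : ε₃ ≤ ε₂ := PLift.down g
          change Side at f
          cases f with
          | l =>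
            apply Met.Hom.ext; funext _
            apply ULift.ext; apply Subtype.ext
            change (0 : ℝ≥0) = min 0 ε₃
            simp
          | r =>
            apply Met.Hom.ext; funext _
            apply ULift.ext; apply Subtype.ext
            change ε₃ = min ε₂ ε₃
            rw [min_eq_right h]
      | a =>
        cases i with
        | num _ => exact PEmpty.elim f
        | a => rfl

section

variable {C : Type u} [Category.{v} C] [MetEnriched C]

/-! ### Basic colimits, subregular epimorphisms, kernel diagrams -/

/-- `f : D a ⟶ Z` is the colimit map of the basic diagram `D`: it is the morphism `u_a(∗)` for the
unit `u` of a colimit `Z` of `D` weighted by the basic weight. -/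
def IsColimitMap (D : BasicShape ⥤ C) {Z : C} (f : D.obj .a ⟶ Z) : Prop :=
  ∃ u : basicWeight.{v} ⟶ homFunctor D Z,
    IsWeightedColimit basicWeight D Z u ∧ Met.fn (u.app (op .a)) PUnit.unit = f

/-- A subregular epimorphism: the colimit map of some basic diagram. -/
def IsSubregularEpi {X Y : C} (e : X ⟶ Y) : Prop :=
  ∃ (D : BasicShape ⥤ C) (h : D.obj .a = X), IsColimitMap D (eqToHom h ≫ e)

/-- `D` is the kernel diagram of `f`: the pair `D l_ε, D r_ε` is the `ε`-kernel pair of `f` for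
every `ε`. (The morphisms `D(ε ⟶ ε')` are then the unique factorizations.) -/
def IsKernelDiagram (D : BasicShape ⥤ C) {Y : C} (f : D.obj .a ⟶ Y) : Prop :=
  ∀ ε : ℝ≥0, IsEpsKernelPair ε f (D.map (BasicShape.left ε)) (D.map (BasicShape.right ε))

/-! ### Reflexive coequalizers -/

/-- `q` is the (conical) coequalizer of `f, g`: precomposition with `q` is an isometric bijection
from `C(Q, Z)` onto the space of all `h : Y ⟶ Z` with `h · f = h · g`. -/
structure IsConicalCoequalizer {X Y Q : C} (f g : X ⟶ Y) (q : Y ⟶ Q) : Prop where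
  condition : f ≫ q = g ≫ q
  isQuotient : IsQuotient q
  factors : ∀ ⦃Z : C⦄ (h : Y ⟶ Z), f ≫ h = g ≫ h → ∃! k : Q ⟶ Z, q ≫ k = h

variable (C) in
/-- `C` has (conical) coequalizers of reflexive pairs, i.e. of parallel pairs of split
epimorphisms with a common splitting. -/
def HasReflexiveConicalCoequalizers : Prop :=
  ∀ ⦃X Y : C⦄ (f g : X ⟶ Y), IsReflexivePair f g →
    ∃ (Q : C) (q : Y ⟶ Q), IsConicalCoequalizer f g q

/-! ### Tensors, copowers, generators -/

/-- `T` is the tensor `M ⊗ K` with unit `η : M ⟶ C(K, T)`: the maps `C(T, X) → Met(M, C(K, X))`,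
`h ↦ C(K, h) · η`, are isomorphisms in `Met` (bijective isometries). -/
structure IsTensor (M : Met.{v}) (K T : C) (η : M ⟶ homSpace K T) : Prop where
  bijective : ∀ X : C, Function.Bijective (fun h : T ⟶ X => η ≫ postcompHom K h)
  isometry : ∀ (X : C) (h h' : T ⟶ X),
    edist h h' = edist (η ≫ postcompHom K h) (η ≫ postcompHom K h')

/-- `K` has tensors: `M ⊗ K` exists for all spaces `M`. -/
def HasTensors (K : C) : Prop :=
  ∀ M : Met.{v}, ∃ (T : C) (η : M ⟶ homSpace K T), IsTensor M K T η

/-- `T` with the injections `ι` is the (conical) copower of `M` copies of `K`. -/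
structure IsCopower (M : Type v) (K T : C) (ι : M → (K ⟶ T)) : Prop where
  factors : ∀ ⦃X : C⦄ (φ : M → (K ⟶ X)), ∃! h : T ⟶ X, ∀ m, ι m ≫ h = φ m
  isometry : ∀ ⦃X : C⦄ (h h' : T ⟶ X), edist h h' = ⨆ m, edist (ι m ≫ h) (ι m ≫ h')

/-- `K` is abstractly finite: every morphism from `K` to a copower `∐_M K` factorizes through a
finite subcopower `∐_{M'} K`, `M' ⊆ M` finite. -/
def IsAbstractlyFinite (K : C) : Prop :=
  ∀ ⦃M : Type v⦄ ⦃T : C⦄ (ι : M → (K ⟶ T)), IsCopower M K T ι → ∀ f : K ⟶ T,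
    ∃ (M' : Set M) (S : C) (κ : M' → (K ⟶ S)) (j : S ⟶ T) (g : K ⟶ S),
      M'.Finite ∧ IsCopower M' K S κ ∧ (∀ m : M', κ m ≫ j = ι m) ∧ g ≫ j = f

/-- `K` is a subregular projective: every morphism from `K` to `Y` factorizes through each
subregular epimorphism `X ⟶ Y`. -/
def IsSubregularProjective (K : C) : Prop :=
  ∀ ⦃X Y : C⦄ (e : X ⟶ Y), IsSubregularEpi e → ∀ f : K ⟶ Y, ∃ g : K ⟶ X, g ≫ e = f

/-- `ev : C(G, K) ⊗ G ⟶ K` is the evaluation morphism: it corresponds to the identity of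
`C(G, K)`. -/
def IsEvaluation {G K T : C} (η : homSpace G K ⟶ homSpace G T) (ev : T ⟶ K) : Prop :=
  η ≫ postcompHom G ev = 𝟙 (homSpace G K)

/-- A subregular generator: an object `G` with tensors for which all evaluation morphisms
`C(G, K) ⊗ G ⟶ K` are subregular epimorphisms. -/
structure IsSubregularGenerator (G : C) : Prop where
  hasTensors : HasTensors G
  evaluation : ∀ ⦃K T : C⦄ (η : homSpace G K ⟶ homSpace G T), IsTensor (homSpace G K) G T η →
    ∀ ev : T ⟶ K, IsEvaluation η ev → IsSubregularEpi ev

/-- A subvarietal generator: an abstractly finite, subregularly projective subregular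
generator. -/
structure IsSubvarietalGenerator (G : C) : Prop extends IsSubregularGenerator G where
  abstractlyFinite : IsAbstractlyFinite G
  projective : IsSubregularProjective G

/-! ### Factorization systems -/

/-- An (orthogonal) factorization system: both classes contain the isomorphisms and are closed
under composition, every morphism factorizes, and diagonal fill-ins exist and are unique. -/
structure IsFactorizationSystem {C : Type u} [Category.{v} C] (E M : MorphismProperty C) :
    Prop where
  iso_left : MorphismProperty.isomorphisms C ≤ E
  iso_right : MorphismProperty.isomorphisms C ≤ M
  comp_left : ∀ ⦃X Y Z : C⦄ (f : X ⟶ Y) (g : Y ⟶ Z), E f → E g → E (f ≫ g)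
  comp_right : ∀ ⦃X Y Z : C⦄ (f : X ⟶ Y) (g : Y ⟶ Z), M f → M g → M (f ≫ g)
  factorization : ∀ ⦃X Y : C⦄ (f : X ⟶ Y),
    ∃ (Z : C) (e : X ⟶ Z) (m : Z ⟶ Y), E e ∧ M m ∧ e ≫ m = f
  diagonal : ∀ ⦃X Y A B : C⦄ (e : X ⟶ Y) (m : A ⟶ B) (p : X ⟶ A) (q : Y ⟶ B), E e → M m →
    p ≫ m = e ≫ q → ∃! d : Y ⟶ A, e ≫ d = p ∧ d ≫ m = q

variable (C)

/-- The class of subregular epimorphisms. -/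
def subregularEpis : MorphismProperty C := fun _ _ e => IsSubregularEpi e

/-- The class of isometric embeddings. -/
def isometricEmbeddings : MorphismProperty C := fun _ _ m => IsIsometricEmbedding m

end

end MetEnr

open MetEnr

namespace MetEnr

section

variable {C : Type u} [Category.{v} C] [MetEnriched C]

/-! ### Elementary facts on metric-enriched categories -/

/-! Objects of `C` behave like metric algebras with underlying space `C(G, X)`: tensors `M ⊗ G` are
the free algebras, and the morphisms `X ⟶ Y` are the nonexpanding maps of underlying spaces that
respect evaluation of terms `G ⟶ M ⊗ G` (`IsSubregularGenerator.exists_hom`). If `M` carries a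
nonexpanding retraction of `M → C(G, M ⊗ G)`, a reflexive coequalizer turns it into an object of `C`
(`exists_reflection`).

This is applied to two spaces. Pairs of points of `X` whose images under `f` have distance at most
`ε` give the `ε`-kernel pair. The image of `C(G, f)` gives the middle object of the factorization;
it is closed under evaluation of terms because `G` is projective with respect to
`isSubregularEpi_freeMap`.

By `isColimitMap_iff`, a colimit map is a quotient with a descent property. Given kernel diagrams,
this makes a morphism a subregular epimorphism exactly when every morphism from `G` lifts along it
(`isSubregularEpi_iff_surjective`). Composition, factorization and the comparison with kernel
diagrams can then be checked on points `G ⟶ X`. -/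

theorem edist_comp_left_le {X Y Z : C} (f : X ⟶ Y) (g g' : Y ⟶ Z) :
    edist (f ≫ g) (f ≫ g') ≤ edist g g' := by
  simpa using MetEnriched.edist_comp_le f f g g'

theorem edist_comp_right_le {X Y Z : C} (f f' : X ⟶ Y) (g : Y ⟶ Z) :
    edist (f ≫ g) (f' ≫ g) ≤ edist f f' := by
  simpa using MetEnriched.edist_comp_le f f' g g

theorem IsQuotient.cancel {X Y Z : C} {e : X ⟶ Y} (he : IsQuotient e) {h h' : Y ⟶ Z}
    (H : e ≫ h = e ≫ h') : h = h' := by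
  apply eq_of_edist_eq_zero
  rw [he, H, edist_self]

theorem IsIsometricEmbedding.cancel {X Y Z : C} {m : Y ⟶ Z} (hm : IsIsometricEmbedding m)
    {h h' : X ⟶ Y} (H : h ≫ m = h' ≫ m) : h = h' := by
  apply eq_of_edist_eq_zero
  rw [hm, H, edist_self]

theorem IsIsometricPair.cancel {P X Q : C} {p p' : P ⟶ X} (hp : IsIsometricPair p p')
    {h h' : Q ⟶ P} (H : h ≫ p = h' ≫ p) (H' : h ≫ p' = h' ≫ p') : h = h' := by
  apply eq_of_edist_eq_zero
  rw [hp, H, H', edist_self, edist_self, max_self]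

/-! ### Colimits weighted by the basic weight in elementary terms -/

/-- The morphisms of the basic shape into `a`. -/
def BasicShape.side (ε : ℝ≥0) (s : Side) : BasicShape.num ε ⟶ BasicShape.a := s

theorem twoPoint.eq_pt {ε : ℝ≥0} (x : twoPoint.{v} ε) : ∃ s, x = twoPoint.pt ε s := by
  obtain ⟨x, rfl | rfl⟩ := x
  exacts [⟨.l, rfl⟩, ⟨.r, rfl⟩]

theorem twoPoint.edist_pt (ε : ℝ≥0) : edist (twoPoint.pt.{v} ε .l) (twoPoint.pt ε .r) = ε := by
  change edist (0 : ℝ≥0) ε = ε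
  rw [edist_nndist, nndist_comm, NNReal.nndist_zero_eq_val']

theorem twoPoint.shrink_pt {ε ε' : ℝ≥0} (h : ε ≤ ε') (s : Side) :
    Met.fn (twoPoint.shrink.{v} h) (twoPoint.pt ε' s) = twoPoint.pt ε s := by
  cases s
  · apply ULift.ext; apply Subtype.ext
    exact min_eq_left zero_le
  · apply ULift.ext; apply Subtype.ext
    exact min_eq_right h

variable {D : BasicShape ⥤ C}

/-- The value of a natural transformation from the basic weight at the point of `B a`. -/
noncomputable def weightLeg {Z : C} (u : basicWeight.{v} ⟶ homFunctor D Z) : D.obj .a ⟶ Z :=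
  Met.fn (u.app (op .a)) PUnit.unit

/-- The values of a natural transformation from the basic weight at the points of `B ε`. -/
noncomputable def weightLegNum {Z : C} (u : basicWeight.{v} ⟶ homFunctor D Z) (ε : ℝ≥0) (s : Side) :
    D.obj (.num ε) ⟶ Z :=
  Met.fn (u.app (op (.num ε))) (twoPoint.pt ε s)

theorem weightLegNum_eq {Z : C} (u : basicWeight.{v} ⟶ homFunctor D Z) (ε : ℝ≥0) (s : Side) :
    weightLegNum u ε s = D.map (BasicShape.side ε s) ≫ weightLeg u :=
  congrArg (fun k : onePoint.{v} ⟶ homSpace (D.obj (.num ε)) Z => Met.fn k PUnit.unit)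
    (u.naturality (BasicShape.side ε s).op)

/-- Both points of `B ε` are images of the point of `B a`, so naturality determines every component
from the one at `a`. -/
theorem weight_hom_ext {Z : C} {u u' : basicWeight.{v} ⟶ homFunctor D Z}
    (H : weightLeg u = weightLeg u') : u = u' := by
  apply NatTrans.ext
  funext ⟨i⟩
  apply Met.Hom.ext
  cases i with
  | a => funext _; exact H
  | num ε =>
    funext x
    obtain ⟨s, rfl⟩ := twoPoint.eq_pt x
    refine (weightLegNum_eq u ε s).trans (Eq.trans ?_ (weightLegNum_eq u' ε s).symm)
    rw [H]

/-- A morphism `h` out of `D a` is compatible with `D` if `d(D l_ε ≫ h, D r_ε ≫ h) ≤ ε` for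
every `ε`. -/
def IsBasicCocone (D : BasicShape ⥤ C) {Z : C} (h : D.obj .a ⟶ Z) : Prop :=
  ∀ ε : ℝ≥0, edist (D.map (BasicShape.left ε) ≫ h) (D.map (BasicShape.right ε) ≫ h) ≤ (ε : ℝ≥0∞)

open Classical in
/-- The map on the points of `B ε` given by a morphism `h` out of `D a`. -/
noncomputable def coconeFun (D : BasicShape ⥤ C) {Z : C} (h : D.obj .a ⟶ Z) (ε : ℝ≥0)
    (x : twoPoint.{v} ε) : D.obj (.num ε) ⟶ Z :=
  if x = twoPoint.pt ε .l then D.map (BasicShape.side ε .l) ≫ h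
  else D.map (BasicShape.side ε .r) ≫ h

theorem IsBasicCocone.coconeFun_pt {Z : C} {h : D.obj .a ⟶ Z} (hh : IsBasicCocone D h) (ε : ℝ≥0)
    (s : Side) : coconeFun D h ε (twoPoint.pt ε s) = D.map (BasicShape.side ε s) ≫ h := by
  cases s
  · exact if_pos rfl
  -- If the two points coincide, their distance `ε` is zero, and the cocone inequality forces the
  -- two values to agree.
  · by_cases hlr : twoPoint.pt.{v} ε .r = twoPoint.pt ε .l
    · refine (if_pos hlr).trans (eq_of_edist_eq_zero (le_antisymm ((hh ε).trans ?_) zero_le))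
      rw [← twoPoint.edist_pt.{v}, hlr, edist_self]
    · exact if_neg hlr

theorem IsBasicCocone.edist_coconeFun_le {Z : C} {h : D.obj .a ⟶ Z} (hh : IsBasicCocone D h)
    (ε : ℝ≥0) (x y : twoPoint.{v} ε) : edist (coconeFun D h ε x) (coconeFun D h ε y) ≤ edist x y := by
  obtain ⟨s, rfl⟩ := twoPoint.eq_pt x
  obtain ⟨t, rfl⟩ := twoPoint.eq_pt y
  rw [hh.coconeFun_pt, hh.coconeFun_pt]
  cases s <;> cases t
  · simp
  · rw [twoPoint.edist_pt]
    exact hh ε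
  · rw [edist_comm, edist_comm (twoPoint.pt ε .r), twoPoint.edist_pt]
    exact hh ε
  · simp

/-- The components of the natural transformation given by a basic cocone. -/
noncomputable def IsBasicCocone.app {Z : C} {h : D.obj .a ⟶ Z} (hh : IsBasicCocone D h) :
    ∀ i : BasicShape, basicWeightObj.{v} i ⟶ homSpace (D.obj i) Z
  | .a => Met.point (M := homSpace (D.obj .a) Z) h
  | .num ε => Met.Hom.mk (M := twoPoint ε) (N := homSpace (D.obj (.num ε)) Z)
      (coconeFun D h ε) (hh.edist_coconeFun_le ε)

/-- The natural transformation given by a basic cocone. -/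
noncomputable def IsBasicCocone.natTrans {Z : C} {h : D.obj .a ⟶ Z} (hh : IsBasicCocone D h) :
    basicWeight.{v} ⟶ homFunctor D Z where
  app i := hh.app i.unop
  naturality := by
    rintro ⟨i⟩ ⟨j⟩ ⟨f⟩
    apply Met.Hom.ext
    cases i with
    | a =>
      cases j with
      | a =>
        funext x
        change h = D.map (𝟙 _) ≫ h
        rw [D.map_id, Category.id_comp]
      | num ε =>
        funext x
        exact hh.coconeFun_pt ε f
    | num ε' =>
      cases j with
      | a => exact PEmpty.elim f
      | num ε =>
        funext x
        obtain ⟨s, rfl⟩ := twoPoint.eq_pt x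
        change coconeFun D h ε (Met.fn (twoPoint.shrink (PLift.down f)) (twoPoint.pt ε' s)) =
          D.map f ≫ coconeFun D h ε' (twoPoint.pt ε' s)
        refine (congrArg (coconeFun D h ε) (twoPoint.shrink_pt (PLift.down f) s)).trans ?_
        rw [hh.coconeFun_pt, hh.coconeFun_pt, ← Category.assoc, ← D.map_comp]
        rfl

theorem isBasicCocone_weightLeg {Z : C} (u : basicWeight.{v} ⟶ homFunctor D Z) :
    IsBasicCocone D (weightLeg u) := by
  intro ε
  have h := (u.app (op (.num ε))).nonexpanding (twoPoint.pt.{v} ε .l) (twoPoint.pt.{v} ε .r)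
  refine le_trans (le_of_eq ?_) (h.trans_eq (twoPoint.edist_pt.{v} ε))
  exact (congrArg₂ edist (weightLegNum_eq u ε .l) (weightLegNum_eq u ε .r)).symm

/-- Transformations out of the basic weight are basic cocones. All components factor through the one
at `a`, so the supremum defining their distance is attained there; the isometry condition of the
colimit thus becomes the quotient property. -/
theorem isColimitMap_iff {Z : C} (f : D.obj .a ⟶ Z) : IsColimitMap D f ↔
    IsBasicCocone D f ∧ IsQuotient f ∧
      ∀ ⦃W : C⦄ (h : D.obj .a ⟶ W), IsBasicCocone D h → ∃ k : Z ⟶ W, f ≫ k = h := by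
  have key : ∀ (u : basicWeight.{v} ⟶ homFunctor D Z) {W : C} (k k' : Z ⟶ W),
      (⨆ j : BasicShapeᵒᵖ, edist ((u ≫ homFunctorMap D k).app j) ((u ≫ homFunctorMap D k').app j))
        = edist (weightLeg u ≫ k) (weightLeg u ≫ k') := by
    intro u W k k'
    apply le_antisymm
    · refine iSup_le fun ⟨j⟩ => iSup_le fun x => ?_
      cases j with
      | a => exact le_rfl
      | num ε =>
        obtain ⟨s, rfl⟩ := twoPoint.eq_pt x
        change edist (weightLegNum u ε s ≫ k) (weightLegNum u ε s ≫ k') ≤ _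
        rw [weightLegNum_eq, Category.assoc, Category.assoc]
        exact edist_comp_left_le _ _ _
    · exact le_trans (le_iSup (fun x : onePoint.{v} =>
        edist (α := homSpace (D.obj .a) W) (Met.fn ((u ≫ homFunctorMap D k).app (op .a)) x)
          (Met.fn ((u ≫ homFunctorMap D k').app (op .a)) x)) PUnit.unit)
        (le_iSup (fun j : BasicShapeᵒᵖ =>
          edist ((u ≫ homFunctorMap D k).app j) ((u ≫ homFunctorMap D k').app j)) (op .a))
  constructor
  · rintro ⟨u, hu, rfl⟩
    refine ⟨isBasicCocone_weightLeg u, fun W k k' => (hu.isometry W k k').trans (key u k k'), ?_⟩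
    intro W h hh
    obtain ⟨k, hk⟩ := (hu.bijective W).2 hh.natTrans
    exact ⟨k, congrArg weightLeg hk⟩
  · rintro ⟨hf, hq, hfac⟩
    refine ⟨hf.natTrans, ⟨fun W => ⟨fun k k' hkk => ?_, fun t => ?_⟩, fun W k k' => ?_⟩, rfl⟩
    · exact hq.cancel (congrArg weightLeg hkk)
    · obtain ⟨k, hk⟩ := hfac _ (isBasicCocone_weightLeg t)
      exact ⟨k, weight_hom_ext hk⟩
    · exact (hq k k').trans (key hf.natTrans k k').symm

end

section

variable {C : Type u} [Category.{v} C] [MetEnriched C] {G : C}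

/-! ### Tensors of a generator with metric spaces -/

/-- The tensor `M ⊗ G`. -/
noncomputable def free (hT : HasTensors G) (M : Type v) [EMetricSpace M] : C :=
  (hT ⟨M⟩).choose

/-- The unit of the tensor `M ⊗ G`, as a morphism of `Met`. -/
noncomputable def freeUnitHom (hT : HasTensors G) (M : Type v) [EMetricSpace M] :
    (⟨M⟩ : Met.{v}) ⟶ homSpace G (free hT M) :=
  (hT ⟨M⟩).choose_spec.choose

theorem isTensor_free (hT : HasTensors G) (M : Type v) [EMetricSpace M] :
    IsTensor ⟨M⟩ G (free hT M) (freeUnitHom hT M) :=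
  (hT ⟨M⟩).choose_spec.choose_spec

variable (hT : HasTensors G) {M N : Type v} [EMetricSpace M] [EMetricSpace N]

/-- The unit of the tensor `M ⊗ G`. -/
noncomputable def freeUnit (x : M) : G ⟶ free hT M := Met.fn (freeUnitHom hT M) x

theorem edist_freeUnit_le (x y : M) : edist (freeUnit hT x) (freeUnit hT y) ≤ edist x y :=
  (freeUnitHom hT M).nonexpanding x y

theorem edist_free_hom {X : C} (h h' : free hT M ⟶ X) :
    edist h h' = ⨆ x : M, edist (freeUnit hT x ≫ h) (freeUnit hT x ≫ h') :=
  (isTensor_free hT M).isometry X h h'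

theorem free_hom_ext {X : C} {h h' : free hT M ⟶ X}
    (H : ∀ x : M, freeUnit hT x ≫ h = freeUnit hT x ≫ h') : h = h' := by
  apply eq_of_edist_eq_zero
  rw [edist_free_hom]
  simp [H]

theorem exists_freeDesc {X : C} (φ : M → (G ⟶ X)) (hφ : ∀ x y, edist (φ x) (φ y) ≤ edist x y) :
    ∃ h : free hT M ⟶ X, ∀ x, freeUnit hT x ≫ h = φ x := by
  obtain ⟨h, hh⟩ := ((isTensor_free hT M).bijective X).2
    (Met.Hom.mk (M := ⟨M⟩) (N := homSpace G X) φ hφ)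
  exact ⟨h, fun x => congrArg (fun k : (⟨M⟩ : Met.{v}) ⟶ homSpace G X => Met.fn k x) hh⟩

/-- The morphism out of `M ⊗ G` corresponding to a nonexpanding map. -/
noncomputable def freeDesc {X : C} (φ : M → (G ⟶ X)) (hφ : ∀ x y, edist (φ x) (φ y) ≤ edist x y) :
    free hT M ⟶ X :=
  (exists_freeDesc hT φ hφ).choose

theorem freeUnit_desc {X : C} (φ : M → (G ⟶ X)) (hφ : ∀ x y, edist (φ x) (φ y) ≤ edist x y)
    (x : M) : freeUnit hT x ≫ freeDesc hT φ hφ = φ x :=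
  (exists_freeDesc hT φ hφ).choose_spec x

theorem freeUnit_desc_assoc {X Y : C} (φ : M → (G ⟶ X))
    (hφ : ∀ x y, edist (φ x) (φ y) ≤ edist x y) (x : M) (k : X ⟶ Y) :
    freeUnit hT x ≫ freeDesc hT φ hφ ≫ k = φ x ≫ k := by
  rw [← Category.assoc, freeUnit_desc]

/-- The morphism `f ⊗ G` for a nonexpanding map `f`. -/
noncomputable def freeMap (f : M → N) (hf : ∀ x y, edist (f x) (f y) ≤ edist x y) :
    free hT M ⟶ free hT N :=
  freeDesc hT (fun x => freeUnit hT (f x)) fun x y => (edist_freeUnit_le hT _ _).trans (hf x y)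

theorem freeUnit_map (f : M → N) (hf : ∀ x y, edist (f x) (f y) ≤ edist x y) (x : M) :
    freeUnit hT x ≫ freeMap hT f hf = freeUnit hT (f x) :=
  freeUnit_desc hT _ _ x

theorem freeUnit_map_assoc {Y : C} (f : M → N) (hf : ∀ x y, edist (f x) (f y) ≤ edist x y) (x : M)
    (k : free hT N ⟶ Y) : freeUnit hT x ≫ freeMap hT f hf ≫ k = freeUnit hT (f x) ≫ k := by
  rw [← Category.assoc, freeUnit_map]

/-- The evaluation morphism `C(G, X) ⊗ G ⟶ X`. -/
noncomputable def freeEval (X : C) : free hT (G ⟶ X) ⟶ X :=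
  freeDesc hT (fun g => g) fun _ _ => le_rfl

theorem freeUnit_eval {X : C} (g : G ⟶ X) : freeUnit hT g ≫ freeEval hT X = g :=
  freeUnit_desc hT _ _ g

theorem freeUnit_eval_assoc {X Y : C} (g : G ⟶ X) (k : X ⟶ Y) :
    freeUnit hT g ≫ freeEval hT X ≫ k = g ≫ k := by
  rw [← Category.assoc, freeUnit_eval]

/-- The coequalizer of the two morphisms `F U F M ⟶ F M` given by a nonexpanding retraction `α` of
the unit `M → C(G, M ⊗ G)`. -/
theorem exists_reflection (hC : HasReflexiveConicalCoequalizers C) (α : (G ⟶ free hT M) → M)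
    (hα : ∀ s t, edist (α s) (α t) ≤ edist s t) (hα' : ∀ x, α (freeUnit hT x) = x) :
    ∃ (Q : C) (c : free hT M ⟶ Q), IsQuotient c ∧ (∀ t, t ≫ c = freeUnit hT (α t) ≫ c) ∧
      ∀ ⦃W : C⦄ (h : free hT M ⟶ W), (∀ t, t ≫ h = freeUnit hT (α t) ≫ h) →
        ∃ k : Q ⟶ W, c ≫ k = h := by
  have hrefl : IsReflexivePair (freeEval hT (free hT M)) (freeMap hT α hα) := by
    -- The common section applies `- ⊗ G` to the unit: a triangle identity splits the evaluation,
    -- and the retraction law for `α` splits `α ⊗ G`.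
    refine ⟨freeMap hT (freeUnit hT) (edist_freeUnit_le hT), ?_, ?_⟩
    · refine free_hom_ext hT fun x => ?_
      rw [freeUnit_map_assoc, freeUnit_eval, Category.comp_id]
    · refine free_hom_ext hT fun x => ?_
      rw [freeUnit_map_assoc, freeUnit_map, Category.comp_id, hα']
  obtain ⟨Q, c, hc⟩ := hC _ _ hrefl
  refine ⟨Q, c, hc.isQuotient, fun t => ?_, fun W h hh => ?_⟩
  · have := congrArg (fun k => freeUnit hT t ≫ k) hc.condition
    simpa only [freeUnit_eval_assoc, freeUnit_map_assoc] using this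
  · refine (hc.factors h (free_hom_ext hT fun t => ?_)).exists
    rw [freeUnit_eval_assoc, freeUnit_map_assoc, hh]

/-! ### Subregular epimorphisms -/

theorem IsSubregularEpi.isQuotient {X Y : C} {e : X ⟶ Y} (he : IsSubregularEpi e) :
    IsQuotient e := by
  obtain ⟨D, rfl, H⟩ := he
  rw [eqToHom_refl, Category.id_comp, isColimitMap_iff] at H
  exact H.2.1

/-- The map `e` is a basic cocone of the diagram presenting it, so any `h` that contracts at least
as much is one too. The criterion no longer mentions the diagram. -/
theorem IsSubregularEpi.exists_desc {X Y : C} {e : X ⟶ Y} (he : IsSubregularEpi e) {W : C}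
    (h : X ⟶ W) (H : ∀ ⦃V : C⦄ (x x' : V ⟶ X), edist (x ≫ h) (x' ≫ h) ≤ edist (x ≫ e) (x' ≫ e)) :
    ∃ k : Y ⟶ W, e ≫ k = h := by
  obtain ⟨D, rfl, hD⟩ := he
  rw [eqToHom_refl, Category.id_comp, isColimitMap_iff] at hD
  exact hD.2.2 h fun ε => (H _ _).trans (hD.1 ε)

theorem isSubregularEpi_freeEval (hG : IsSubregularGenerator G) (X : C) :
    IsSubregularEpi (freeEval hG.hasTensors X) :=
  hG.evaluation (freeUnitHom hG.hasTensors (G ⟶ X)) (isTensor_free hG.hasTensors (G ⟶ X)) _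
    (Met.Hom.ext (funext fun g => freeUnit_eval hG.hasTensors g))

/-- Evaluation is a quotient, and distances out of a tensor are computed on its generators. Hence
metric questions can be tested on morphisms from `G`. -/
theorem IsSubregularGenerator.edist_eq_iSup (hG : IsSubregularGenerator G) {X Y : C}
    (u u' : X ⟶ Y) : edist u u' = ⨆ g : G ⟶ X, edist (g ≫ u) (g ≫ u') := by
  rw [(isSubregularEpi_freeEval hG X).isQuotient, edist_free_hom]
  simp only [freeUnit_eval_assoc]

theorem IsSubregularGenerator.hom_ext (hG : IsSubregularGenerator G) {X Y : C} {u u' : X ⟶ Y}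
    (H : ∀ g : G ⟶ X, g ≫ u = g ≫ u') : u = u' := by
  apply eq_of_edist_eq_zero
  rw [hG.edist_eq_iSup]
  simp [H]

theorem IsSubregularGenerator.isIsometricEmbedding (hG : IsSubregularGenerator G) {X Y : C}
    {m : X ⟶ Y} (H : ∀ g g' : G ⟶ X, edist g g' ≤ edist (g ≫ m) (g' ≫ m)) :
    IsIsometricEmbedding m := by
  intro U u u'
  refine le_antisymm ?_ (edist_comp_right_le _ _ _)
  rw [hG.edist_eq_iSup]
  refine iSup_le fun g => (H _ _).trans ?_
  rw [Category.assoc, Category.assoc]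
  exact edist_comp_left_le _ _ _

theorem IsSubregularEpi.exists_desc_of_generator (hG : IsSubregularGenerator G) {X Y : C}
    {e : X ⟶ Y} (he : IsSubregularEpi e) {W : C} (h : X ⟶ W)
    (H : ∀ x x' : G ⟶ X, edist (x ≫ h) (x' ≫ h) ≤ edist (x ≫ e) (x' ≫ e)) :
    ∃ k : Y ⟶ W, e ≫ k = h := by
  refine he.exists_desc h fun V x x' => ?_
  rw [hG.edist_eq_iSup]
  refine iSup_le fun g => ?_
  rw [← Category.assoc, ← Category.assoc]
  refine (H _ _).trans ?_
  rw [Category.assoc, Category.assoc]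
  exact edist_comp_left_le _ _ _

/-- A nonexpanding map `C(G, V) → C(G, W)` which preserves the algebra structures given by
evaluation is composition with a morphism `V ⟶ W`. -/
theorem IsSubregularGenerator.exists_hom (hG : IsSubregularGenerator G) {V W : C}
    (φ : (G ⟶ V) → (G ⟶ W)) (hφ : ∀ x y, edist (φ x) (φ y) ≤ edist x y)
    (H : ∀ t : G ⟶ free hG.hasTensors (G ⟶ V),
      φ (t ≫ freeEval hG.hasTensors V) = t ≫ freeDesc hG.hasTensors φ hφ) :
    ∃ k : V ⟶ W, ∀ g, g ≫ k = φ g := by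
  -- By `H`, the extension of `φ` to the free object takes on each term the value of `φ` at its
  -- evaluation; it therefore contracts at least as much as evaluation and descends along it.
  obtain ⟨k, hk⟩ := (isSubregularEpi_freeEval hG V).exists_desc_of_generator hG
    (freeDesc hG.hasTensors φ hφ) fun t t' => by
      rw [← H, ← H]
      exact hφ _ _
  refine ⟨k, fun g => ?_⟩
  rw [← freeUnit_eval_assoc hG.hasTensors g k, hk, freeUnit_desc]

end

section

variable {C : Type u} [Category.{v} C] [MetEnriched C] {G : C}

/-! ### Kernel pairs and kernel diagrams -/

/-- The admissible pairs of points of `X` form a space `M` with the maximum metric, and evaluating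
terms in both coordinates retracts `C(G, M ⊗ G)` onto `M`. The object `Q` reflected from `M` turns
out to have exactly `M` as its space of points, without projectivity of `G`. -/
theorem exists_isEpsKernelPair (hC : HasReflexiveConicalCoequalizers C)
    (hG : IsSubregularGenerator G) {X Y : C} (f : X ⟶ Y) (ε : ℝ≥0) :
    ∃ (P : C) (p p' : P ⟶ X), IsEpsKernelPair ε f p p' := by
  have hT := hG.hasTensors
  let M : Type v := {x : (G ⟶ X) × (G ⟶ X) // edist (x.1 ≫ f) (x.2 ≫ f) ≤ (ε : ℝ≥0∞)}
  have hM : ∀ x y : M, edist x y = max (edist x.1.1 y.1.1) (edist x.1.2 y.1.2) := fun _ _ => rfl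
  have h₁ : ∀ x y : M, edist x.1.1 y.1.1 ≤ edist x y := fun x y =>
    (le_max_left _ _).trans_eq (hM x y).symm
  have h₂ : ∀ x y : M, edist x.1.2 y.1.2 ≤ edist x y := fun x y =>
    (le_max_right _ _).trans_eq (hM x y).symm
  obtain ⟨p₁, hp₁⟩ := exists_freeDesc hT (fun x : M => x.1.1) h₁
  obtain ⟨p₂, hp₂⟩ := exists_freeDesc hT (fun x : M => x.1.2) h₂
  have hp : edist (p₁ ≫ f) (p₂ ≫ f) ≤ (ε : ℝ≥0∞) := by
    rw [edist_free_hom]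
    refine iSup_le fun x => ?_
    rw [← Category.assoc, ← Category.assoc, hp₁, hp₂]
    exact x.2
  let α : (G ⟶ free hT M) → M := fun t => ⟨(t ≫ p₁, t ≫ p₂), by
    rw [Category.assoc, Category.assoc]
    exact (edist_comp_left_le _ _ _).trans hp⟩
  have hα : ∀ s t, edist (α s) (α t) ≤ edist s t := fun s t => by
    rw [hM]
    exact max_le (edist_comp_right_le _ _ _) (edist_comp_right_le _ _ _)
  have hαu : ∀ x, α (freeUnit hT x) = x := fun x =>
    Subtype.ext (Prod.ext (hp₁ x) (hp₂ x))
  obtain ⟨Q, c, hcq, hc, hfac⟩ := exists_reflection hT hC α hα hαu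
  obtain ⟨p, rfl : c ≫ p = p₁⟩ := hfac p₁ fun t => (hp₁ (α t)).symm
  obtain ⟨p', rfl : c ≫ p' = p₂⟩ := hfac p₂ fun t => (hp₂ (α t)).symm
  have hpp : edist (p ≫ f) (p' ≫ f) ≤ (ε : ℝ≥0∞) := by
    rw [hcq, ← Category.assoc, ← Category.assoc]
    exact hp
  let s : (G ⟶ Q) → M := fun g => ⟨(g ≫ p, g ≫ p'), by
    rw [Category.assoc, Category.assoc]
    exact (edist_comp_left_le _ _ _).trans hpp⟩
  have hs : ∀ g g', edist (s g) (s g') ≤ edist g g' := fun g g' => by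
    rw [hM]
    exact max_le (edist_comp_right_le _ _ _) (edist_comp_right_le _ _ _)
  have hs₁ : freeMap hT s hs ≫ c ≫ p = freeEval hT Q ≫ p := free_hom_ext hT fun g => by
    rw [freeUnit_map_assoc, freeUnit_eval_assoc, hp₁]
  have hs₂ : freeMap hT s hs ≫ c ≫ p' = freeEval hT Q ≫ p' := free_hom_ext hT fun g => by
    rw [freeUnit_map_assoc, freeUnit_eval_assoc, hp₂]
  have hαs : ∀ t : G ⟶ free hT (G ⟶ Q), α (t ≫ freeMap hT s hs) = s (t ≫ freeEval hT Q) := by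
    refine fun t => Subtype.ext (Prod.ext ?_ ?_)
    · change (t ≫ _) ≫ c ≫ p = (t ≫ _) ≫ p
      rw [Category.assoc, hs₁, Category.assoc]
    · change (t ≫ _) ≫ c ≫ p' = (t ≫ _) ≫ p'
      rw [Category.assoc, hs₂, Category.assoc]
  have hsc : ∀ g g', edist (freeUnit hT (s g) ≫ c) (freeUnit hT (s g') ≫ c) ≤ edist (s g) (s g') :=
    fun g g' => (edist_comp_right_le _ _ _).trans (edist_freeUnit_le hT _ _)
  -- every morphism `G ⟶ Q` comes from a point of `M`
  obtain ⟨k, hk⟩ := hG.exists_hom (fun g : G ⟶ Q => freeUnit hT (s g) ≫ c)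
    (fun g g' => (hsc g g').trans (hs g g')) (fun t => by
      have : freeDesc hT (fun g : G ⟶ Q => freeUnit hT (s g) ≫ c)
          (fun g g' => (hsc g g').trans (hs g g')) = freeMap hT s hs ≫ c :=
        free_hom_ext hT fun g => by rw [freeUnit_desc, freeUnit_map_assoc]
      rw [this, ← Category.assoc, hc (t ≫ freeMap hT s hs), hαs])
  -- The endomorphism `k` fixes the images in `Q` of the generators of `M ⊗ G`, and morphisms out of
  -- `Q` are determined there since `c` is a quotient.
  have hk1 : k = 𝟙 Q := by
    refine hcq.cancel (free_hom_ext hT fun x => ?_)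
    rw [Category.comp_id, ← Category.assoc, hk]
    congr 2
    refine Subtype.ext (Prod.ext ?_ ?_)
    · change (_ ≫ c) ≫ p = _
      rw [Category.assoc, hp₁]
    · change (_ ≫ c) ≫ p' = _
      rw [Category.assoc, hp₂]
  have hsr : ∀ g, freeUnit hT (s g) ≫ c = g := fun g => by rw [← hk, hk1, Category.comp_id]
  have hiso : IsIsometricPair p p' := by
    intro U u₁ u₂
    refine le_antisymm ?_ (max_le (edist_comp_right_le _ _ _) (edist_comp_right_le _ _ _))
    rw [hG.edist_eq_iSup]
    refine iSup_le fun g => ?_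
    -- Points of `Q` are recovered from their two coordinates by a nonexpanding map, so their
    -- distance is at most the maximum of the coordinate distances.
    have h := hsc (g ≫ u₁) (g ≫ u₂)
    rw [hsr, hsr, hM] at h
    refine h.trans (max_le_max ?_ ?_)
    · change edist ((g ≫ u₁) ≫ p) ((g ≫ u₂) ≫ p) ≤ _
      rw [Category.assoc, Category.assoc]
      exact edist_comp_left_le _ _ _
    · change edist ((g ≫ u₁) ≫ p') ((g ≫ u₂) ≫ p') ≤ _
      rw [Category.assoc, Category.assoc]
      exact edist_comp_left_le _ _ _
  refine ⟨Q, p, p', hiso, hpp, fun V q q' hq => ?_⟩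
  let σ : (G ⟶ V) → M := fun g => ⟨(g ≫ q, g ≫ q'), by
    rw [Category.assoc, Category.assoc]
    exact (edist_comp_left_le _ _ _).trans hq⟩
  have hσ : ∀ g g', edist (freeUnit hT (σ g) ≫ c) (freeUnit hT (σ g') ≫ c) ≤ edist g g' :=
    fun g g' => (edist_comp_right_le _ _ _).trans ((edist_freeUnit_le hT _ _).trans
      ((hM _ _).trans_le (max_le (edist_comp_right_le _ _ _) (edist_comp_right_le _ _ _))))
  have hσ₁ : ∀ g, (freeUnit hT (σ g) ≫ c) ≫ p = g ≫ q := fun g => by rw [Category.assoc, hp₁]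
  have hσ₂ : ∀ g, (freeUnit hT (σ g) ≫ c) ≫ p' = g ≫ q' := fun g => by rw [Category.assoc, hp₂]
  have hd₁ : freeDesc hT (fun g => freeUnit hT (σ g) ≫ c) hσ ≫ p = freeEval hT V ≫ q :=
    free_hom_ext hT fun g => by rw [freeUnit_desc_assoc, freeUnit_eval_assoc, hσ₁]
  have hd₂ : freeDesc hT (fun g => freeUnit hT (σ g) ≫ c) hσ ≫ p' = freeEval hT V ≫ q' :=
    free_hom_ext hT fun g => by rw [freeUnit_desc_assoc, freeUnit_eval_assoc, hσ₂]
  -- Compatibility with evaluation holds after each projection, because `q` and `q'` are morphisms;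
  -- the isometric pair reflects it.
  obtain ⟨t, ht⟩ := hG.exists_hom (fun g : G ⟶ V => freeUnit hT (σ g) ≫ c) hσ fun t => by
    refine hiso.cancel ?_ ?_
    · rw [hσ₁, Category.assoc, Category.assoc, hd₁]
    · rw [hσ₂, Category.assoc, Category.assoc, hd₂]
  refine ⟨t, hG.hom_ext fun g => ?_, hG.hom_ext fun g => ?_⟩
  · rw [← Category.assoc, ht, hσ₁]
  · rw [← Category.assoc, ht, hσ₂]

/-- Universality of the `ε'`-kernel pair supplies the transition maps, and joint cancellation of its
two projections makes them functorial. -/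
theorem exists_isKernelDiagram_of_pairs {X Y : C} (f : X ⟶ Y)
    (H : ∀ ε : ℝ≥0, ∃ (P : C) (p p' : P ⟶ X), IsEpsKernelPair ε f p p') :
    ∃ (D : BasicShape ⥤ C) (h : D.obj .a = X), IsKernelDiagram D (eqToHom h ≫ f) := by
  choose P l r hP using H
  have hstep : ∀ {ε ε' : ℝ≥0}, ε ≤ ε' → ∃ t : P ε ⟶ P ε', t ≫ l ε' = l ε ∧ t ≫ r ε' = r ε :=
    fun {ε ε'} h => (hP ε').factors _ _ ((hP ε).edist_le.trans (by exact_mod_cast h))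
  choose t htl htr using @hstep
  let obj : BasicShape → C
    | .num ε => P ε
    | .a => X
  let map : ∀ {i j : BasicShape}, BasicShape.Hom i j → (obj i ⟶ obj j)
    | .num _, .num _, h => t h.down
    | .num ε, .a, .l => l ε
    | .num ε, .a, .r => r ε
    | .a, .a, _ => 𝟙 X
    | .a, .num _, h => h.elim
  refine ⟨{ obj := obj, map := fun h => map h, map_id := ?_, map_comp := ?_ }, rfl, ?_⟩
  · intro i
    cases i with
    | a => rfl
    | num ε =>
      exact (hP ε).isometric.cancel ((htl _).trans (Category.id_comp _).symm)
        ((htr _).trans (Category.id_comp _).symm)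
  · intro i j k g h
    cases k with
    | a =>
      cases j with
      | a => cases i <;> exact (Category.comp_id _).symm
      | num ε' =>
        cases i with
        | a => exact PEmpty.elim g
        | num ε =>
          change Side at h
          cases h
          · exact (htl (PLift.down g)).symm
          · exact (htr (PLift.down g)).symm
    | num ε'' =>
      cases j with
      | a => exact PEmpty.elim h
      | num ε' =>
        cases i with
        | a => exact PEmpty.elim g
        | num ε =>
          apply (hP ε'').isometric.cancel
          · refine (htl _).trans (Eq.symm ((Category.assoc _ _ _).trans ?_))
            exact (congrArg (t (PLift.down g) ≫ ·) (htl (PLift.down h))).trans (htl _)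
          · refine (htr _).trans (Eq.symm ((Category.assoc _ _ _).trans ?_))
            exact (congrArg (t (PLift.down g) ≫ ·) (htr (PLift.down h))).trans (htr _)
  · rw [eqToHom_refl, Category.id_comp]
    exact hP

theorem exists_isKernelDiagram (hC : HasReflexiveConicalCoequalizers C)
    (hG : IsSubregularGenerator G) {X Y : C} (f : X ⟶ Y) :
    ∃ (D : BasicShape ⥤ C) (h : D.obj .a = X), IsKernelDiagram D (eqToHom h ≫ f) :=
  exists_isKernelDiagram_of_pairs f (exists_isEpsKernelPair hC hG f)

/-- For a compatible cocone of a kernel diagram of `f`, distances are bounded by those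
after composition with `f`. -/
theorem IsKernelDiagram.edist_le {D : BasicShape ⥤ C} {Y : C} {f : D.obj .a ⟶ Y}
    (hD : IsKernelDiagram D f) {W : C} {h : D.obj .a ⟶ W} (hh : IsBasicCocone D h) {V : C}
    (x x' : V ⟶ D.obj .a) : edist (x ≫ h) (x' ≫ h) ≤ edist (x ≫ f) (x' ≫ f) := by
  by_cases htop : edist (x ≫ f) (x' ≫ f) = ⊤
  · rw [htop]
    exact le_top
  -- Take `δ` to be the exact distance after `f`: the pair then factors through the `δ`-kernel pair,
  -- where the cocone condition gives the bound `δ`.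
  · obtain ⟨δ, hδ⟩ := WithTop.ne_top_iff_exists.1 htop
    obtain ⟨t, rfl, rfl⟩ := (hD δ).factors x x' hδ.symm.le
    rw [← hδ, Category.assoc, Category.assoc]
    exact (edist_comp_left_le _ _ _).trans (hh δ)

theorem IsKernelDiagram.isBasicCocone {D : BasicShape ⥤ C} {Y : C} {f : D.obj .a ⟶ Y}
    (hD : IsKernelDiagram D f) : IsBasicCocone D f :=
  fun ε => (hD ε).edist_le

/-- A quotient `e` that satisfies the universal property of the colimit map of a kernel diagram
is a subregular epimorphism. -/
theorem isSubregularEpi_of_exists_desc (hC : HasReflexiveConicalCoequalizers C)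
    (hG : IsSubregularGenerator G) {X Y : C} {e : X ⟶ Y} (he : IsQuotient e)
    (H : ∀ ⦃W : C⦄ (h : X ⟶ W),
      (∀ ⦃V : C⦄ (x x' : V ⟶ X), edist (x ≫ h) (x' ≫ h) ≤ edist (x ≫ e) (x' ≫ e)) →
        ∃ k : Y ⟶ W, e ≫ k = h) : IsSubregularEpi e := by
  obtain ⟨D, rfl, hD⟩ := exists_isKernelDiagram hC hG e
  refine ⟨D, rfl, ?_⟩
  rw [eqToHom_refl, Category.id_comp] at hD ⊢
  rw [isColimitMap_iff]
  exact ⟨hD.isBasicCocone, he, fun W h hh => H h fun V x x' => hD.edist_le hh x x'⟩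

/-! ### Subregular epimorphisms and surjectivity -/

/-- A set-theoretic section of `f` suffices for descent: whatever contracts at least as much as `f ⊗
G` is constant on the fibres of `f` and nonexpanding for the metric of `N`. -/
theorem isSubregularEpi_freeMap (hC : HasReflexiveConicalCoequalizers C)
    (hG : IsSubregularGenerator G) {M N : Type v} [EMetricSpace M] [EMetricSpace N] (f : M → N)
    (hf : ∀ x y, edist (f x) (f y) ≤ edist x y) (hs : Function.Surjective f) :
    IsSubregularEpi (freeMap hG.hasTensors f hf) := by
  have hT := hG.hasTensors
  refine isSubregularEpi_of_exists_desc hC hG (fun W k k' => ?_) fun W h H => ?_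
  · refine le_antisymm ?_ (edist_comp_left_le _ _ _)
    rw [edist_free_hom]
    refine iSup_le fun y => ?_
    obtain ⟨x, rfl⟩ := hs y
    rw [← freeUnit_map_assoc hT f hf, ← freeUnit_map_assoc hT f hf]
    exact edist_comp_left_le _ _ _
  · have hle : ∀ x x' : M, edist (freeUnit hT x ≫ h) (freeUnit hT x' ≫ h) ≤ edist (f x) (f x') := by
      intro x x'
      refine (H _ _).trans ?_
      rw [freeUnit_map, freeUnit_map]
      exact edist_freeUnit_le hT _ _
    have hinv := Function.surjInv_eq hs
    refine ⟨freeDesc hT (fun y => freeUnit hT (Function.surjInv hs y) ≫ h) fun y y' => ?_,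
      free_hom_ext hT fun x => ?_⟩
    · refine (hle _ _).trans ?_
      rw [hinv, hinv]
    · rw [freeUnit_map_assoc, freeUnit_desc]
      apply eq_of_edist_eq_zero
      refine le_antisymm ((hle _ _).trans ?_) zero_le
      rw [hinv, edist_self]

/-- Descent along `e` is defined on points through arbitrary lifts. To see that it respects
evaluation, a term over points of `Y` is lifted to one over points of `X`, which projectivity of `G`
allows since the map of free objects is already known to be a subregular epimorphism. -/
theorem isSubregularEpi_of_surjective (hC : HasReflexiveConicalCoequalizers C)
    (hG : IsSubvarietalGenerator G) {X Y : C} {e : X ⟶ Y}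
    (he : ∀ g : G ⟶ Y, ∃ x : G ⟶ X, x ≫ e = g) : IsSubregularEpi e := by
  have hT := hG.hasTensors
  have hS := hG.toIsSubregularGenerator
  refine isSubregularEpi_of_exists_desc hC hS (fun W k k' => ?_) fun W h H => ?_
  · refine le_antisymm ?_ (edist_comp_left_le _ _ _)
    rw [hS.edist_eq_iSup]
    refine iSup_le fun g => ?_
    obtain ⟨x, rfl⟩ := he g
    rw [Category.assoc, Category.assoc]
    exact edist_comp_left_le _ _ _
  · choose σ hσ using he
    have hσh : ∀ x : G ⟶ X, σ (x ≫ e) ≫ h = x ≫ h := fun x => by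
      apply eq_of_edist_eq_zero
      refine le_antisymm ((H _ _).trans ?_) zero_le
      rw [hσ, edist_self]
    have hle : ∀ g g' : G ⟶ Y, edist (σ g ≫ h) (σ g' ≫ h) ≤ edist g g' := fun g g' => by
      refine (H _ _).trans ?_
      rw [hσ, hσ]
    have hF := isSubregularEpi_freeMap hC hS (fun x : G ⟶ X => x ≫ e)
      (fun _ _ => edist_comp_right_le _ _ e) fun g => ⟨σ g, hσ g⟩
    obtain ⟨k, hk⟩ := hS.exists_hom (fun g => σ g ≫ h) hle fun t => by
      obtain ⟨t, rfl⟩ := hG.projective _ hF t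
      have h₁ : freeMap hT (fun x : G ⟶ X => x ≫ e) (fun _ _ => edist_comp_right_le _ _ e) ≫
          freeEval hT Y = freeEval hT X ≫ e :=
        free_hom_ext hT fun x => by
          rw [freeUnit_map_assoc, freeUnit_eval, freeUnit_eval_assoc]
      have h₂ : freeMap hT (fun x : G ⟶ X => x ≫ e) (fun _ _ => edist_comp_right_le _ _ e) ≫
          freeDesc hT (fun g => σ g ≫ h) hle = freeEval hT X ≫ h :=
        free_hom_ext hT fun x => by
          rw [freeUnit_map_assoc, freeUnit_desc, freeUnit_eval_assoc, hσh]
      rw [Category.assoc, h₁, Category.assoc, h₂, ← Category.assoc, hσh, Category.assoc]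
    refine ⟨k, hS.hom_ext fun x => ?_⟩
    rw [← Category.assoc, hk, hσh]

theorem isSubregularEpi_iff_surjective (hC : HasReflexiveConicalCoequalizers C)
    (hG : IsSubvarietalGenerator G) {X Y : C} {e : X ⟶ Y} :
    IsSubregularEpi e ↔ ∀ g : G ⟶ Y, ∃ x : G ⟶ X, x ≫ e = g :=
  ⟨fun he g => hG.projective e he g, isSubregularEpi_of_surjective hC hG⟩

/-! ### The factorization system -/

theorem exists_factorization (hC : HasReflexiveConicalCoequalizers C)
    (hG : IsSubvarietalGenerator G) {X Y : C} (f : X ⟶ Y) :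
    ∃ (Z : C) (e : X ⟶ Z) (m : Z ⟶ Y), IsSubregularEpi e ∧ IsIsometricEmbedding m ∧ e ≫ m = f := by
  have hT := hG.hasTensors
  have hS := hG.toIsSubregularGenerator
  let M : Type v := {y : G ⟶ Y // ∃ x : G ⟶ X, x ≫ f = y}
  let i : free hT M ⟶ Y := freeDesc hT (fun y : M => y.1) fun _ _ => le_rfl
  have hi : ∀ y : M, freeUnit hT y ≫ i = y.1 := freeUnit_desc hT _ _
  let φ : (G ⟶ X) → M := fun x => ⟨x ≫ f, x, rfl⟩
  have hφ : ∀ x x', edist (φ x) (φ x') ≤ edist x x' := fun x x' => edist_comp_right_le x x' f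
  have hF := isSubregularEpi_freeMap hC hS φ hφ (by rintro ⟨_, x, rfl⟩; exact ⟨x, rfl⟩)
  have hφi : freeMap hT φ hφ ≫ i = freeEval hT X ≫ f := free_hom_ext hT fun x => by
    rw [freeUnit_map_assoc, hi, freeUnit_eval_assoc]
  -- The image is closed under evaluation: a term over image points lifts to a term over points of
  -- `X`, whose value there is mapped by `f` to the required one.
  let α : (G ⟶ free hT M) → M := fun t => ⟨t ≫ i, by
    obtain ⟨t, rfl⟩ := hG.projective _ hF t
    exact ⟨t ≫ freeEval hT X, by rw [Category.assoc, Category.assoc, hφi]⟩⟩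
  obtain ⟨Z, c, hcq, hc, hfac⟩ := exists_reflection hT hC α
    (fun s t => edist_comp_right_le s t i) fun y => Subtype.ext (hi y)
  obtain ⟨m, hm⟩ := hfac i fun t => (hi (α t)).symm
  have hce : IsSubregularEpi c := by
    -- The coequalizer identifies `t` with the generator at `α t`, so anything contracting at least
    -- as much as `c` identifies them as well.
    refine isSubregularEpi_of_exists_desc hC hS hcq fun W h H => hfac h fun t => ?_
    apply eq_of_edist_eq_zero
    refine le_antisymm ((H _ _).trans ?_) zero_le
    rw [hc, edist_self]
  have hcs : ∀ g : G ⟶ Z, ∃ y : M, freeUnit hT y ≫ c = g := fun g => by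
    obtain ⟨t, rfl⟩ := hG.projective c hce g
    exact ⟨α t, (hc t).symm⟩
  have hym : ∀ y : M, (freeUnit hT y ≫ c) ≫ m = y.1 := fun y => by rw [Category.assoc, hm, hi]
  -- Points of `Z` come from `M`, whose metric is inherited from `C(G, Y)`; passing from `M` to `Z`
  -- cannot increase distances.
  have hmi : IsIsometricEmbedding m := hS.isIsometricEmbedding fun g g' => by
    obtain ⟨y, rfl⟩ := hcs g
    obtain ⟨y', rfl⟩ := hcs g'
    rw [hym, hym]
    exact (edist_comp_right_le _ _ _).trans (edist_freeUnit_le hT y y')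
  have hle : ∀ x x' : G ⟶ X, edist (freeUnit hT (φ x) ≫ c) (freeUnit hT (φ x') ≫ c) ≤ edist x x' :=
    fun x x' => (edist_comp_right_le _ _ _).trans ((edist_freeUnit_le hT _ _).trans (hφ x x'))
  have hdm : freeDesc hT (fun x => freeUnit hT (φ x) ≫ c) hle ≫ m = freeEval hT X ≫ f :=
    free_hom_ext hT fun x => by rw [freeUnit_desc_assoc, hym, freeUnit_eval_assoc]
  obtain ⟨e, he⟩ := hS.exists_hom (fun x => freeUnit hT (φ x) ≫ c) hle fun t => by
    refine hmi.cancel ?_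
    rw [hym, Category.assoc, hdm]
    exact Category.assoc _ _ _
  refine ⟨Z, e, m, isSubregularEpi_of_surjective hC hG fun g => ?_, hmi, hS.hom_ext fun x => ?_⟩
  · obtain ⟨⟨_, x, rfl⟩, rfl⟩ := hcs g
    exact ⟨x, he x⟩
  · rw [← Category.assoc, he, hym]

theorem isFactorizationSystem (hC : HasReflexiveConicalCoequalizers C)
    (hG : IsSubvarietalGenerator G) :
    IsFactorizationSystem (subregularEpis C) (isometricEmbeddings C) where
  iso_left X Y f (hf : IsIso f) := (isSubregularEpi_iff_surjective hC hG).2 fun g =>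
    ⟨g ≫ inv f, by simp⟩
  iso_right X Y f (hf : IsIso f) U u₁ u₂ := by
    refine le_antisymm ?_ (edist_comp_right_le _ _ _)
    simpa using edist_comp_right_le (u₁ ≫ f) (u₂ ≫ f) (inv f)
  comp_left X Y Z f g hf hg := by
    have hf' := (isSubregularEpi_iff_surjective hC hG).1 hf
    have hg' := (isSubregularEpi_iff_surjective hC hG).1 hg
    refine (isSubregularEpi_iff_surjective hC hG).2 fun z => ?_
    obtain ⟨y, rfl⟩ := hg' z
    obtain ⟨x, rfl⟩ := hf' y
    exact ⟨x, (Category.assoc _ _ _).symm⟩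
  comp_right X Y Z f g hf hg U u₁ u₂ := by
    rw [hf u₁ u₂, hg (u₁ ≫ f) (u₂ ≫ f), Category.assoc, Category.assoc]
  factorization X Y f := exists_factorization hC hG f
  diagonal := by
    intro X Y A B e m p q (he : IsSubregularEpi e) (hm : IsIsometricEmbedding m) hsq
    -- As `m` is isometric, distances after `p` equal those after `e ≫ q`, hence are at most those
    -- after `e`.
    obtain ⟨d, hd⟩ := he.exists_desc p fun V x x' => by
      rw [hm, Category.assoc, Category.assoc, hsq, ← Category.assoc, ← Category.assoc]
      exact edist_comp_right_le _ _ _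
    refine ⟨d, ⟨hd, he.isQuotient.cancel ?_⟩, fun d' hd' => he.isQuotient.cancel ?_⟩
    · rw [← Category.assoc, hd, hsq]
    · rw [hd'.1, hd]

/-! ### Colimits of kernel diagrams -/

/-- Composing with an isometric `m` changes no distances, so the kernel diagram of `e ≫ m` serves
for `e` itself. -/
theorem IsKernelDiagram.isColimitMap {D : BasicShape ⥤ C} {Y Z : C} {e : D.obj .a ⟶ Z}
    {m : Z ⟶ Y} (hD : IsKernelDiagram D (e ≫ m)) (he : IsSubregularEpi e)
    (hm : IsIsometricEmbedding m) : IsColimitMap D e := by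
  refine (isColimitMap_iff e).2 ⟨fun ε => ?_, he.isQuotient, fun W h hh => ?_⟩
  · rw [hm, Category.assoc, Category.assoc]
    exact hD.isBasicCocone ε
  · refine he.exists_desc h fun V x x' => (hD.edist_le hh x x').trans ?_
    rw [← Category.assoc, ← Category.assoc]
    exact edist_comp_right_le _ _ _

/-- Points of `Z` lift to `D a` by projectivity, and there a cocone `e` of the kernel diagram never
separates points more than `e ≫ m` does. -/
theorem IsKernelDiagram.isIsometricEmbedding (hG : IsSubvarietalGenerator G)
    {D : BasicShape ⥤ C} {Y Z : C} {e : D.obj .a ⟶ Z} {m : Z ⟶ Y}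
    (hD : IsKernelDiagram D (e ≫ m)) (he : IsBasicCocone D e) (hs : IsSubregularEpi e) :
    IsIsometricEmbedding m := by
  refine hG.toIsSubregularGenerator.isIsometricEmbedding fun g g' => ?_
  obtain ⟨x, rfl⟩ := hG.projective e hs g
  obtain ⟨x', rfl⟩ := hG.projective e hs g'
  simpa only [Category.assoc] using hD.edist_le he x x'

end

end MetEnr

theorem propositionP {C : Type u} [Category.{v} C] [MetEnriched C]
    (hC : HasReflexiveConicalCoequalizers C) (G : C) (hG : IsSubvarietalGenerator G) :
    IsFactorizationSystem (subregularEpis C) (isometricEmbeddings C) ∧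
    -- every morphism has a kernel diagram
    (∀ (X Y : C) (f : X ⟶ Y), ∃ (D : BasicShape ⥤ C) (h : D.obj .a = X),
      IsKernelDiagram D (eqToHom h ≫ f)) ∧
    -- the colimit of the kernel diagram exists, and yields the factorization
    (∀ (D : BasicShape ⥤ C) (Y : C) (f : D.obj .a ⟶ Y), IsKernelDiagram D f →
      (∃ (Z : C) (e : D.obj .a ⟶ Z), IsColimitMap D e) ∧
      ∀ (Z : C) (e : D.obj .a ⟶ Z), IsColimitMap D e →
        IsSubregularEpi e ∧ (∃! m : Z ⟶ Y, e ≫ m = f) ∧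
          ∀ m : Z ⟶ Y, e ≫ m = f → IsIsometricEmbedding m) := by
  refine ⟨isFactorizationSystem hC hG,
    fun X Y f => exists_isKernelDiagram hC hG.toIsSubregularGenerator f, fun D Y f hD => ⟨?_, ?_⟩⟩
  · obtain ⟨Z, e, m, he, hm, rfl⟩ := exists_factorization hC hG f
    exact ⟨Z, e, hD.isColimitMap he hm⟩
  · intro Z e he
    have hs : IsSubregularEpi e := ⟨D, rfl, by rwa [eqToHom_refl, Category.id_comp]⟩
    obtain ⟨hcocone, hq, hfac⟩ := (isColimitMap_iff e).1 he
    obtain ⟨m, hm⟩ := hfac f hD.isBasicCocone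
    refine ⟨hs, ⟨m, hm, fun m' hm' => hq.cancel (hm'.trans hm.symm)⟩, fun m' hm' => ?_⟩
    subst hm'
    exact hD.isIsometricEmbedding hG hcocone hs
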